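/- Let $|C_4\rangle=\frac14\sum_{x\in\{0,1\}^4}(-1)^{x_1x_2+x_2x_3+x_3x_4}|x_1x_2x_3x_4\rangle$ be the linear cluster state on four qubits, and for $\lambda\in[0,1]$ let $$\rho_4^{WC}=\lambda\,|C_4\rangle\langle C_4|+\frac{1-\lambda}{4}\sum_{i=1}^4 Z_i|C_4\rangle\langle C_4|Z_i$$ be the worst-case state, where $Z_i$ is the Pauli $Z$ operator on qubit $i$. For $\theta\in\mathbb R$ put $|\theta\rangle=\cos\frac\theta2|0\rangle+\sin\frac\theta2|1\rangle$, so that $\{|\theta\rangle,|\theta+\pi\rangle\}$ is the orthonormal basis of a projective measurement in the $X$–$Z$ plane. Let $p(\theta_2,\theta_3)$ be the probability of finding qubits 2 and 3 of $\rho_4^{WC}$ in $|\theta_2\rangle$ and $|\theta_3\rangle$, let $\rho_{1,4}(\theta_2,\theta_3)$ be the resulting normalized state of qubits 1 and 4, and let $C$ denote the (Wootters) concurrence: $C(\rho)=\max\{0,l_1-l_2-l_3-l_4\}$, where $l_1\ge l_2\ge l_3\ge l_4$ are the square roots of the eigenvalues of $\rho\,(Y\otimes Y)\rho^*(Y\otimes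 Y)$. For all $\theta_2,\theta_3\in\mathbb R$ we have $p(\theta_2,\theta_3)>0$ and $$C(\rho_{1,4}(\theta_2,\theta_3))=\max\Big\{0,\ \tfrac12(3\lambda-1)\,|S|+\tfrac12(\lambda-1)\Big\},\qquad S=\sin\theta_2\sin\theta_3 .$$ In particular, the formula holds with $S$ in place of $|S|$ whenever $S\ge0$ (for instance for $\theta_2,\theta_3\in[0,\pi]$). The average localized entanglement $$E(\theta_2,\theta_3)=\sum_{s_2,s_3\in\{0,1\}}p(\theta_2+s_2\pi,\theta_3+s_3\pi)\,C\big(\rho_{1,4}(\theta_2+s_2\pi,\theta_3+s_3\pi)\big)$$ has the same value $\max\{0,\tfrac12(3\lambda-1)|S|+\tfrac12(\lambda-1)\}$. Hence equatorial measurements (those with $|S|=1$, in particular $\theta_2=\theta_3=\frac\pi2$) maximize both $C(\rho_{1,4}(\theta_2,\theta_3))$ and $E(\theta_2,\theta_3)$ over all $\theta_2,\theta_3\in\mathbb R$, and the maximum is $\max\{0,2\lambda-1\}$. -/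

import Mathlib

open scoped Matrix Kronecker

noncomputable section

namespace WCState

/-- Pauli `Y`. -/
def pauliY : Matrix (Fin 2) (Fin 2) ℂ := !![0, -Complex.I; Complex.I, 0]

/-- Linear operators on `n` qubits, as matrices in the computational basis. The basis vectors are
the bit strings `x : Fin n → Fin 2`. -/
abbrev QubitOp (n : ℕ) := Matrix (Fin n → Fin 2) (Fin n → Fin 2) ℂ

/-- Operators on a pair of qubits. -/
abbrev TwoQubitOp := Matrix (Fin 2 × Fin 2) (Fin 2 × Fin 2) ℂ

/-- The linear cluster state `|C_n⟩`: controlled-phase gates between neighbouring qubits, applied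
to `|+⟩^{⊗ n}`. The amplitude of `|x⟩` is `2^{-n/2} ∏ (-1)^{x_i x_{i+1}}`. -/
def clusterKet (n : ℕ) : (Fin n → Fin 2) → ℂ := fun x =>
  ((1 / Real.sqrt (2 ^ n) : ℝ) : ℂ) *
    ∏ i : Fin n, ∏ j : Fin n,
      if (i : ℕ) + 1 = (j : ℕ) then (-1 : ℂ) ^ ((x i : ℕ) * (x j : ℕ)) else 1

/-- The projector `|ψ⟩⟨ψ|` (for a unit vector `ψ`). -/
def ketBra {ι : Type*} (ψ : ι → ℂ) : Matrix ι ι ℂ := Matrix.vecMulVec ψ (star ψ)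

/-- The Pauli operator `Z_i` on qubit `i` of `n`. -/
def pauliZAt (n : ℕ) (i : Fin n) : QubitOp n :=
  Matrix.diagonal fun x => (-1 : ℂ) ^ (x i : ℕ)

/-- The worst-case state
`ρ_n = lam |C_n⟩⟨C_n| + ((1 - lam)/n) ∑ i, Z_i |C_n⟩⟨C_n| Z_i`. -/
def wcState (n : ℕ) (lam : ℝ) : QubitOp n :=
  (lam : ℂ) • ketBra (clusterKet n) +
    (((1 - lam) / n : ℝ) : ℂ) •
      ∑ i : Fin n, pauliZAt n i * ketBra (clusterKet n) * pauliZAt n i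

/-- The X–Z plane qubit state `|θ⟩ = cos (θ/2) |0⟩ + sin (θ/2) |1⟩`. -/
def xzKet (θ : ℝ) : Fin 2 → ℂ :=
  ![((Real.cos (θ / 2) : ℝ) : ℂ), ((Real.sin (θ / 2) : ℝ) : ℂ)]

/-- The map `1 ⊗ |θ₂⟩ ⊗ |θ₃⟩ ⊗ 1` from qubits `1, 4` to four qubits (qubits `1, 2, 3, 4` have
indices `0, 1, 2, 3`). -/
def middleKet (θ₂ θ₃ : ℝ) : Matrix (Fin 4 → Fin 2) (Fin 2 × Fin 2) ℂ :=
  Matrix.of fun x p =>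
    if x 0 = p.1 ∧ x 3 = p.2 then xzKet θ₂ (x 1) * xzKet θ₃ (x 2) else 0

/-- The unnormalized state `⟨θ₂|⟨θ₃| ρ |θ₂⟩|θ₃⟩` of qubits `1, 4`. -/
def unnormalizedPost (ρ : QubitOp 4) (θ₂ θ₃ : ℝ) : TwoQubitOp :=
  (middleKet θ₂ θ₃)ᴴ * ρ * middleKet θ₂ θ₃

/-- The probability of finding the qubits `2, 3` of `ρ` in `|θ₂⟩, |θ₃⟩`. -/
def outcomeProb (ρ : QubitOp 4) (θ₂ θ₃ : ℝ) : ℝ :=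
  (unnormalizedPost ρ θ₂ θ₃).trace.re

/-- The normalized state of qubits `1, 4` after qubits `2, 3` were found in `|θ₂⟩, |θ₃⟩`. -/
def postState (ρ : QubitOp 4) (θ₂ θ₃ : ℝ) : TwoQubitOp :=
  (unnormalizedPost ρ θ₂ θ₃).trace⁻¹ • unnormalizedPost ρ θ₂ θ₃

/-- The spin-flipped state `(Y ⊗ Y) ρ* (Y ⊗ Y)`, where `*` is entrywise complex conjugation. -/
def spinFlip (ρ : TwoQubitOp) : TwoQubitOp :=
  (pauliY ⊗ₖ pauliY) * ρ.map (starRingEnd ℂ) * (pauliY ⊗ₖ pauliY)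

/-- The square roots of the four eigenvalues of `ρ * spinFlip ρ`, with algebraic multiplicity, in
decreasing order. For a density matrix `ρ` these eigenvalues are real and nonnegative. -/
def concurrenceSpectrum (ρ : TwoQubitOp) : List ℝ :=
  ((ρ * spinFlip ρ).charpoly.roots.map fun z => Real.sqrt z.re).sort (fun a b => a ≥ b)

/-- Wootters' concurrence `max {0, l₁ - l₂ - l₃ - l₄}` of a two-qubit density matrix, where
`l₁ ≥ l₂ ≥ l₃ ≥ l₄` are the square roots of the eigenvalues of `ρ * spinFlip ρ`. -/
def concurrence (ρ : TwoQubitOp) : ℝ :=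
  max 0 ((concurrenceSpectrum ρ).getD 0 0 - (concurrenceSpectrum ρ).getD 1 0
    - (concurrenceSpectrum ρ).getD 2 0 - (concurrenceSpectrum ρ).getD 3 0)

/-- The average concurrence between qubits `1, 4` that is localized by the projective measurements
of qubits `2, 3` in the orthonormal bases `{|θ₂⟩, |θ₂ + π⟩}` and `{|θ₃⟩, |θ₃ + π⟩}`. -/
def localizedEntanglement (ρ : QubitOp 4) (θ₂ θ₃ : ℝ) : ℝ :=
  ∑ s₂ : Fin 2, ∑ s₃ : Fin 2,
    outcomeProb ρ (θ₂ + (s₂ : ℕ) * Real.pi) (θ₃ + (s₃ : ℕ) * Real.pi) *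
      concurrence (postState ρ (θ₂ + (s₂ : ℕ) * Real.pi) (θ₃ + (s₃ : ℕ) * Real.pi))

end WCState

end

/-!
Read as a matrix from qubits 2, 3 to qubits 1, 4, the cluster ket is half the unitary
`(H ⊗ H) CZ`. Measuring qubits 2, 3 therefore teleports a product state through this gate: every
outcome has probability `1/4`, and qubits 1, 4 are left in a mixture of five pure states, one for
each error, with weights `D = diag (λ, μ, μ, μ, μ)` where `μ = (1 - λ)/4`.

By Wootters, `ρ * spinFlip ρ` has the same nonzero eigenvalues as `D τᴴ D τ`, where `τ` is the
matrix of overlaps of the five states under `Y ⊗ Y`. Pulling back through the gate turns `Y ⊗ Y`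
into `X ⊗ X`, which makes the overlaps elementary: `τ` is real and symmetric, so the eigenvalues
are the squares of those of `D τ`, and `τ` splits into the scalar `S = sin θ₂ sin θ₃` and `-S` plus
a weighted path on four vertices. Hence `D τ` has eigenvalues `λS`, `μ(1 - S)`, `-μ(1 + S)`,
`-2μS` and `0`, and the concurrence is twice the largest absolute value among them minus the sum of
all absolute values, cut off at `0`. When the largest is not `λ|S|`, it is `μ(1 + |S|)` and the
concurrence vanishes.
-/

noncomputable section

namespace WCState

open Matrix Polynomial

section Charpoly

variable {R n : Type*} [CommRing R] [Fintype n] [DecidableEq n]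

lemma expand_two_charpoly_mul_self (N : Matrix n n R) :
    expand R 2 (N * N).charpoly = (-1) ^ Fintype.card n * (N.charpoly * N.charpoly.comp (-X)) := by
  have hexpand : (expand R 2).toRingHom.mapMatrix (charmatrix (N * N)) =
      scalar n (X ^ 2) - (C.mapMatrix N) * (C.mapMatrix N) := by
    rw [charmatrix, map_sub, map_mul]
    ext i j : 2
    simp [diagonal_apply, apply_ite, mul_apply]
  have hcomp : (compRingHom (-X)).mapMatrix (charmatrix N) =
      -(scalar n X + C.mapMatrix N) := by
    ext i j : 2
    by_cases h : i = j <;> simp [h, sub_eq_add_neg, add_comm]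
  have hfactor : scalar n (X ^ 2 : R[X]) - C.mapMatrix N * C.mapMatrix N =
      charmatrix N * (scalar n X + C.mapMatrix N) := by
    have hcomm := scalar_commute (X : R[X]) (Commute.all _) (C.mapMatrix N)
    rw [charmatrix, ← hcomm.mul_self_sub_mul_self_eq', sq, map_mul]
  calc expand R 2 (N * N).charpoly
      = ((expand R 2).toRingHom.mapMatrix (charmatrix (N * N))).det :=
        RingHom.map_det (expand R 2).toRingHom _
    _ = N.charpoly * (-((compRingHom (-X)).mapMatrix (charmatrix N))).det := by
        rw [hexpand, hcomp, hfactor, det_mul, charpoly, neg_neg]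
    _ = N.charpoly * ((-1) ^ Fintype.card n * N.charpoly.comp (-X)) := by
        rw [det_neg, ← RingHom.map_det, charpoly, coe_compRingHom_apply]
    _ = _ := mul_left_comm _ _ _

lemma charpoly_mul_self_eq_prod {N : Matrix n n R} {s : Multiset R}
    (h : N.charpoly = (s.map fun a => X - C a).prod) :
    (N * N).charpoly = ((s.map (· ^ 2)).map fun a => X - C a).prod := by
  nontriviality R
  have hcard : Fintype.card n = s.card := by
    rw [← N.charpoly_natDegree_eq_dim, h, natDegree_multiset_prod_X_sub_C_eq_card]
  apply expand_injective two_pos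
  rw [expand_two_charpoly_mul_self, hcard, h]
  have hsign : (-1 : R[X]) ^ s.card = (s.map fun _ => (-1 : R[X])).prod := by
    rw [Multiset.map_const', Multiset.prod_replicate]
  rw [multiset_prod_comp, Multiset.map_map, map_multiset_prod, Multiset.map_map, hsign,
    ← Multiset.prod_map_mul, ← Multiset.prod_map_mul, Multiset.map_map]
  congr 2
  ext1 a
  simp only [Function.comp_apply, sub_comp, X_comp, C_comp, map_sub, expand_X, expand_C]
  rw [C_pow]
  ring

/-- The matrix `s + A`, where `A` is the weighted adjacency matrix of the path on `Fin 4` that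
visits `1, 3, 0, 2` along edges of weights `p, q, r`. -/
def pathMatrix (s p q r : R) : Matrix (Fin 4) (Fin 4) R :=
  !![s, 0, r, q; 0, s, 0, p; r, 0, s, 0; q, p, 0, s]

lemma smul_pathMatrix (c s p q r : R) :
    c • pathMatrix s p q r = pathMatrix (c * s) (c * p) (c * q) (c * r) := by
  simp [pathMatrix]

lemma conjTranspose_pathMatrix [StarRing R] (s p q r : R) :
    (pathMatrix s p q r)ᴴ = pathMatrix (star s) (star p) (star q) (star r) := by
  ext i j
  fin_cases i <;> fin_cases j <;> simp [pathMatrix]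

lemma charpoly_pathMatrix {p q r α β : R} (s : R)
    (hsum : p ^ 2 + q ^ 2 + r ^ 2 = α ^ 2 + β ^ 2) (hprod : p ^ 2 * r ^ 2 = α ^ 2 * β ^ 2) :
    (pathMatrix s p q r).charpoly =
      (({s + α, s - α, s + β, s - β} : Multiset R).map fun a => X - C a).prod := by
  have hsumC : (C p ^ 2 + C q ^ 2 + C r ^ 2 : R[X]) = C α ^ 2 + C β ^ 2 := by
    simp only [← C_pow, ← C_add, hsum]
  have hprodC : (C p ^ 2 * C r ^ 2 : R[X]) = C α ^ 2 * C β ^ 2 := by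
    simp only [← C_pow, ← C_mul, hprod]
  have hdet : (pathMatrix s p q r).charpoly =
      (X - C s) ^ 4 - (C p ^ 2 + C q ^ 2 + C r ^ 2) * (X - C s) ^ 2 + C p ^ 2 * C r ^ 2 := by
    simp [Matrix.charpoly, charmatrix, pathMatrix, det_succ_row_zero, Fin.sum_univ_succ,
      Fin.succAbove]
    ring
  rw [hdet, hsumC, hprodC]
  simp only [Multiset.insert_eq_cons, Multiset.map_cons, map_add, map_sub, Multiset.map_singleton,
    Multiset.prod_cons, Multiset.prod_singleton]
  ring

end Charpoly

section Ket

variable {ι κ : Type*}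

lemma ketBra_smul (c : ℂ) (ψ : ι → ℂ) : ketBra (c • ψ) = (c * star c) • ketBra ψ := by
  simp only [ketBra, star_smul, smul_vecMulVec, vecMulVec_smul, smul_smul, mul_comm c]

lemma trace_ketBra [Fintype ι] (ψ : ι → ℂ) : (ketBra ψ).trace = star ψ ⬝ᵥ ψ := by
  rw [ketBra, trace_vecMulVec, dotProduct_comm]

lemma star_mulVec_dotProduct_mulVec {R : Type*} [Semiring R] [StarRing R] [Fintype ι] [Fintype κ]
    [DecidableEq ι] {U : Matrix κ ι R} (hU : Uᴴ * U = 1) (ψ : ι → R) :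
    star (U *ᵥ ψ) ⬝ᵥ (U *ᵥ ψ) = star ψ ⬝ᵥ ψ := by
  rw [star_mulVec, ← dotProduct_mulVec, mulVec_mulVec, hU, one_mulVec]

lemma mul_ketBra_mul_conjTranspose [Fintype ι] (A : Matrix κ ι ℂ) (ψ : ι → ℂ) :
    A * ketBra ψ * Aᴴ = ketBra (A *ᵥ ψ) := by
  rw [ketBra, ketBra, mul_vecMulVec, vecMulVec_mul, star_mulVec]

/-- The mixture `∑ k, w k |ψ k⟩⟨ψ k|` of an ensemble of pure states. -/
def ensembleState [Fintype κ] (w : κ → ℝ) (ψ : κ → ι → ℂ) : Matrix ι ι ℂ :=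
  ∑ k, (w k : ℂ) • ketBra (ψ k)

lemma ensembleState_eq_mul_diagonal_mul [Fintype κ] [DecidableEq κ] (w : κ → ℝ)
    (ψ : κ → ι → ℂ) :
    ensembleState w ψ = (of ψ)ᵀ * diagonal (fun k => (w k : ℂ)) * (of ψ)ᵀᴴ := by
  ext i j
  simp only [ensembleState, ketBra, Matrix.sum_apply, Matrix.smul_apply, vecMulVec_apply,
    smul_eq_mul, mul_apply (N := (of ψ)ᵀᴴ), mul_diagonal, conjTranspose_apply, transpose_apply,
    of_apply, Pi.star_apply]
  exact Finset.sum_congr rfl fun k _ => by ring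

lemma trace_ensembleState [Fintype ι] [Fintype κ] (w : κ → ℝ) {ψ : κ → ι → ℂ}
    (hψ : ∀ k, star (ψ k) ⬝ᵥ ψ k = 1) :
    (ensembleState w ψ).trace = ∑ k, (w k : ℂ) := by
  simp only [ensembleState, trace_sum, trace_smul, trace_ketBra, hψ, smul_eq_mul, mul_one]

lemma mul_ensembleState_mul_conjTranspose {ι' : Type*} [Fintype ι] [Fintype κ] (w : κ → ℝ)
    (ψ : κ → ι → ℂ) (A : Matrix ι' ι ℂ) :
    A * ensembleState w ψ * Aᴴ = ensembleState w fun k => A *ᵥ ψ k := by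
  simp only [ensembleState, Matrix.mul_sum, Matrix.sum_mul, Matrix.mul_smul, Matrix.smul_mul,
    mul_ketBra_mul_conjTranspose]

lemma ensembleState_smul [Fintype κ] (w : κ → ℝ) (c : ℂ) (ψ : κ → ι → ℂ) :
    ensembleState w (fun k => c • ψ k) = (c * star c) • ensembleState w ψ := by
  simp only [ensembleState, ketBra_smul, smul_comm _ (c * star c), Finset.smul_sum]

/-- The tensor product `|v⟩|w⟩` of two kets. -/
def prodKet (v : ι → ℂ) (w : κ → ℂ) : ι × κ → ℂ := fun p => v p.1 * w p.2

lemma star_prodKet (v : ι → ℂ) (w : κ → ℂ) : star (prodKet v w) = prodKet (star v) (star w) := by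
  ext p
  simp [prodKet]

lemma prodKet_dotProduct_prodKet [Fintype ι] [Fintype κ] (v v' : ι → ℂ) (w w' : κ → ℂ) :
    prodKet v w ⬝ᵥ prodKet v' w' = (v ⬝ᵥ v') * (w ⬝ᵥ w') := by
  simp only [dotProduct, prodKet, Fintype.sum_mul_sum, Fintype.sum_prod_type, mul_mul_mul_comm]

lemma kronecker_mulVec_prodKet {ι' κ' : Type*} [Fintype ι] [Fintype κ] (A : Matrix ι' ι ℂ)
    (B : Matrix κ' κ ℂ) (v : ι → ℂ) (w : κ → ℂ) :
    (A ⊗ₖ B) *ᵥ prodKet v w = prodKet (A *ᵥ v) (B *ᵥ w) := by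
  ext p
  simp only [mulVec, dotProduct, prodKet, kroneckerMap_apply, Fintype.sum_mul_sum,
    Fintype.sum_prod_type, mul_mul_mul_comm]

end Ket

section Concurrence

/-- Wootters' matrix of the overlaps `⟨ψ k|* (Y ⊗ Y) |ψ l⟩`. -/
def tildeMatrix {κ : Type*} (ψ : κ → Fin 2 × Fin 2 → ℂ) : Matrix κ κ ℂ :=
  of fun k l => ψ k ⬝ᵥ ((pauliY ⊗ₖ pauliY) *ᵥ ψ l)

lemma tildeMatrix_eq_mul_mul {κ : Type*} (ψ : κ → Fin 2 × Fin 2 → ℂ) :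
    tildeMatrix ψ = of ψ * (pauliY ⊗ₖ pauliY) * (of ψ)ᵀ := by
  ext k l
  rw [Matrix.mul_assoc]
  rfl

lemma isHermitian_pauliY : pauliY.IsHermitian := by
  ext i j
  fin_cases i <;> fin_cases j <;> simp [pauliY]

lemma charpoly_ensembleState_mul_spinFlip {κ : Type*} [Fintype κ] [DecidableEq κ] (w : κ → ℝ)
    (ψ : κ → Fin 2 × Fin 2 → ℂ) :
    X ^ Fintype.card κ * (ensembleState w ψ * spinFlip (ensembleState w ψ)).charpoly =
      X ^ 4 * (diagonal (fun k => (w k : ℂ)) * (tildeMatrix ψ)ᴴ *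
        (diagonal (fun k => (w k : ℂ)) * tildeMatrix ψ)).charpoly := by
  set D : Matrix κ κ ℂ := diagonal fun k => (w k : ℂ)
  set A : Matrix (Fin 2 × Fin 2) κ ℂ := (of ψ)ᵀ
  have hD : D.map (starRingEnd ℂ) = D := by
    simp [D, diagonal_map]
  have hconj : (ensembleState w ψ).map (starRingEnd ℂ) = Aᵀᴴ * D * Aᵀ := by
    rw [ensembleState_eq_mul_diagonal_mul, Matrix.map_mul, Matrix.map_mul, hD]
    congr 1
    ext i j
    simp [A]
  have hadj : (tildeMatrix ψ)ᴴ = Aᴴ * (pauliY ⊗ₖ pauliY) * Aᵀᴴ := by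
    rw [tildeMatrix_eq_mul_mul, conjTranspose_mul, conjTranspose_mul, conjTranspose_kronecker,
      isHermitian_pauliY.eq, Matrix.mul_assoc]
    rfl
  have hprod : ensembleState w ψ * spinFlip (ensembleState w ψ) =
      A * (D * Aᴴ * (pauliY ⊗ₖ pauliY) * Aᵀᴴ * D * Aᵀ * (pauliY ⊗ₖ pauliY)) := by
    rw [spinFlip, hconj, ensembleState_eq_mul_diagonal_mul]
    simp only [Matrix.mul_assoc, A, D]
  have hcomm := charpoly_mul_comm' A
    (D * Aᴴ * (pauliY ⊗ₖ pauliY) * Aᵀᴴ * D * Aᵀ * (pauliY ⊗ₖ pauliY))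
  rw [hprod, hcomm, hadj, tildeMatrix_eq_mul_mul]
  simp only [Matrix.mul_assoc, A, transpose_transpose]
  rfl

lemma concurrence_eq_of_roots {ρ : TwoQubitOp} {s : Multiset ℝ} {a : ℝ}
    (hroots : (ρ * spinFlip ρ).charpoly.roots = s.map fun b : ℝ => (b : ℂ) ^ 2) (ha : a ∈ s)
    (hmax : ∀ b ∈ s, |b| ≤ |a|) :
    concurrence ρ = max 0 (2 * |a| - (s.map fun b => |b|).sum) := by
  have hcard : s.card = 4 := by
    rw [← Multiset.card_map (fun b : ℝ => (b : ℂ) ^ 2), ← hroots,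
      ← (IsAlgClosed.splits _).natDegree_eq_card_roots, charpoly_natDegree_eq_dim]
    rfl
  obtain ⟨t, rfl⟩ := Multiset.exists_cons_of_mem ha
  have hsqrt (b : ℝ) : √((b : ℂ) ^ 2).re = |b| := by
    rw [← Complex.ofReal_pow, Complex.ofReal_re, Real.sqrt_sq_eq_abs]
  have hspec : concurrenceSpectrum ρ = |a| :: (t.map fun b => |b|).sort (· ≥ ·) := by
    have hle : ∀ x ∈ t.map fun b => |b|, |a| ≥ x := by
      simpa using fun b hb => hmax b (Multiset.mem_cons_of_mem hb)
    rw [← Multiset.sort_cons _ _ (· ≥ ·) hle, ← Multiset.map_cons, concurrenceSpectrum, hroots,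
      Multiset.map_map]
    simp only [Function.comp_def, hsqrt]
  obtain ⟨x, y, z, hxyz⟩ : ∃ x y z, (t.map fun b => |b|).sort (· ≥ ·) = [x, y, z] := by
    rw [← List.length_eq_three, Multiset.length_sort, Multiset.card_map]
    simpa using hcard
  have hsum : (t.map fun b => |b|).sum = x + (y + z) := by
    rw [← Multiset.sort_eq (t.map fun b => |b|) (· ≥ ·), hxyz]
    simp
  rw [concurrence, hspec, hxyz, Multiset.map_cons, Multiset.sum_cons, hsum]
  simp only [List.getD_cons_zero, List.getD_cons_succ]
  ring_nf

end Concurrence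

section WorstCase

lemma isHermitian_pauliZAt (n : ℕ) (i : Fin n) : (pauliZAt n i).IsHermitian := by
  simp [pauliZAt, IsHermitian, diagonal_conjTranspose, Pi.star_def]

/-- The weights of the worst-case ensemble: `inl ()` stands for no error, `inr i` for the error
`Z` on qubit `i`. -/
def errorWeight (n : ℕ) (lam : ℝ) : Unit ⊕ Fin n → ℝ :=
  Sum.elim (fun _ => lam) fun _ => (1 - lam) / n

/-- The phase errors of the worst-case ensemble: `inl ()` stands for no error, `inr i` for the
error `Z` on qubit `i`. -/
def phaseError (n : ℕ) : Unit ⊕ Fin n → QubitOp n :=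
  Sum.elim (fun _ => 1) (pauliZAt n)

lemma wcState_eq_ensembleState (n : ℕ) (lam : ℝ) :
    wcState n lam =
      ensembleState (errorWeight n lam) fun k => phaseError n k *ᵥ clusterKet n := by
  simp only [wcState, ensembleState, Fintype.sum_sum_type, Finset.univ_unique, Finset.sum_singleton,
    errorWeight, phaseError, Sum.elim_inl, Sum.elim_inr, one_mulVec]
  simp only [← mul_ketBra_mul_conjTranspose, (isHermitian_pauliZAt n _).eq, Finset.smul_sum]

/-- Pauli `X`. -/
def pauliX : Matrix (Fin 2) (Fin 2) ℂ := !![0, 1; 1, 0]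

/-- Pauli `Z`. -/
def pauliZ : Matrix (Fin 2) (Fin 2) ℂ := !![1, 0; 0, -1]

/-- The gate `(H ⊗ H) CZ`, where `H` is the Hadamard gate: the four-qubit linear cluster state,
read as a matrix from qubits `2, 3` to qubits `1, 4`, is half this gate. -/
def clusterGate : TwoQubitOp :=
  of fun p q => 1 / 2 * (-1) ^ ((p.1 : ℕ) * q.1 + (q.1 : ℕ) * q.2 + (q.2 : ℕ) * p.2)

/-- The tensor factors on qubit `2` of the errors of `phaseError 4`, pulled through `clusterGate`:
the Hadamard gate turns `Z` on an outer qubit into `X` on the adjacent inner one, and `CZ` then adds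
a `Z` on the other inner qubit. -/
def leftError : Unit ⊕ Fin 4 → Matrix (Fin 2) (Fin 2) ℂ :=
  Sum.elim (fun _ => 1) ![pauliX, pauliZ, 1, pauliZ]

/-- The tensor factors on qubit `3` of the errors of `phaseError 4`, as in `leftError`. -/
def rightError : Unit ⊕ Fin 4 → Matrix (Fin 2) (Fin 2) ℂ :=
  Sum.elim (fun _ => 1) ![pauliZ, 1, pauliZ, pauliX]

/-- The normalized state of qubits `1, 4` once qubits `2, 3` of the cluster state with error `k`
were found in `|θ₂⟩, |θ₃⟩`. -/
def outerKet (θ₂ θ₃ : ℝ) (k : Unit ⊕ Fin 4) : Fin 2 × Fin 2 → ℂ :=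
  clusterGate *ᵥ prodKet (leftError k *ᵥ xzKet θ₂) (rightError k *ᵥ xzKet θ₃)

lemma star_xzKet (θ : ℝ) : star (xzKet θ) = xzKet θ := by
  ext b
  fin_cases b <;> exact Complex.conj_ofReal _

lemma xzKet_dotProduct_mulVec (θ : ℝ) (M : Matrix (Fin 2) (Fin 2) ℂ) :
    xzKet θ ⬝ᵥ (M *ᵥ xzKet θ) = (M 0 0 + M 1 1) / 2 + (M 0 0 - M 1 1) / 2 * Real.cos θ +
      (M 0 1 + M 1 0) / 2 * Real.sin θ := by
  have hcos := Complex.cos_two_mul (θ / 2 : ℂ)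
  have hsin := Complex.sin_two_mul (θ / 2 : ℂ)
  have hone := Complex.sin_sq_add_cos_sq (θ / 2 : ℂ)
  rw [mul_div_cancel₀ _ two_ne_zero] at hcos hsin
  simp only [dotProduct, xzKet, Complex.ofReal_cos, Complex.ofReal_div, Complex.ofReal_ofNat,
    Complex.ofReal_sin, mulVec, Fin.sum_univ_two, Fin.isValue, cons_val_zero, cons_val_one,
    cons_val_fin_one, hcos, hsin]
  linear_combination M 1 1 * hone

lemma clusterGate_transpose_mul_pauliY_mul :
    clusterGateᵀ * (pauliY ⊗ₖ pauliY) * clusterGate = pauliX ⊗ₖ pauliX := by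
  ext ⟨a, b⟩ ⟨c, d⟩
  fin_cases a <;> fin_cases b <;> fin_cases c <;> fin_cases d <;>
    norm_num [mul_apply, Fintype.sum_prod_type, Fin.sum_univ_two, clusterGate, pauliY, pauliX]

lemma clusterGate_conjTranspose_mul_self : clusterGateᴴ * clusterGate = 1 := by
  ext ⟨a, b⟩ ⟨c, d⟩
  fin_cases a <;> fin_cases b <;> fin_cases c <;> fin_cases d <;>
    norm_num [mul_apply, Fintype.sum_prod_type, Fin.sum_univ_two, clusterGate, Matrix.one_apply]

lemma sum_fin_four_bits {M : Type*} [AddCommMonoid M] (f : (Fin 4 → Fin 2) → M) :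
    ∑ x, f x = ∑ a, ∑ b, ∑ c, ∑ d, f ![a, b, c, d] := by
  simp only [← (Fin.consEquiv fun _ => Fin 2).sum_comp, Fintype.sum_prod_type, Fintype.sum_unique]
  rfl

lemma clusterKet_four (a b c d : Fin 2) :
    clusterKet 4 ![a, b, c, d] = 1 / 2 * clusterGate (a, d) (b, c) := by
  have hsqrt : √(2 ^ 4 : ℝ) = 4 := by
    rw [show (2 ^ 4 : ℝ) = 4 ^ 2 by norm_num, Real.sqrt_sq (by norm_num)]
  simp [clusterKet, hsqrt, clusterGate, Fin.prod_univ_four, pow_add]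
  ring

lemma middleKet_conjTranspose_mulVec (θ₂ θ₃ : ℝ) (ψ : (Fin 4 → Fin 2) → ℂ) (a d : Fin 2) :
    ((middleKet θ₂ θ₃)ᴴ *ᵥ ψ) (a, d) =
      ∑ b, ∑ c, xzKet θ₂ b * xzKet θ₃ c * ψ ![a, b, c, d] := by
  have hreal (θ : ℝ) (b : Fin 2) : (starRingEnd ℂ) (xzKet θ b) = xzKet θ b :=
    congrFun (star_xzKet θ) b
  simp only [mulVec, dotProduct, sum_fin_four_bits, middleKet, conjTranspose_apply, of_apply,
    cons_val, ite_and, apply_ite star, star_mul', star_zero, ite_mul, zero_mul]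
  simp [hreal]

lemma phaseError_mulVec_clusterKet_four (k : Unit ⊕ Fin 4) (a b c d : Fin 2) :
    (phaseError 4 k *ᵥ clusterKet 4) ![a, b, c, d] =
      1 / 2 * (clusterGate * (leftError k ⊗ₖ rightError k)) (a, d) (b, c) := by
  rcases k with _ | i
  · simp only [phaseError, leftError, rightError, Sum.elim_inl, one_mulVec, clusterKet_four,
      one_kronecker_one, Matrix.mul_one]
  · rw [phaseError, Sum.elim_inr, pauliZAt, mulVec_diagonal, clusterKet_four, mul_left_comm]
    congr 1
    fin_cases i <;> fin_cases a <;> fin_cases b <;> fin_cases c <;> fin_cases d <;>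
      norm_num [mul_apply, Fintype.sum_prod_type, Fin.sum_univ_two, clusterGate, leftError,
        rightError, pauliX, pauliZ]

lemma middleKet_conjTranspose_mulVec_phaseError (θ₂ θ₃ : ℝ) (k : Unit ⊕ Fin 4) :
    (middleKet θ₂ θ₃)ᴴ *ᵥ (phaseError 4 k *ᵥ clusterKet 4) = (1 / 2 : ℂ) • outerKet θ₂ θ₃ k := by
  ext ⟨a, d⟩
  rw [middleKet_conjTranspose_mulVec, outerKet, ← kronecker_mulVec_prodKet, mulVec_mulVec]
  simp only [phaseError_mulVec_clusterKet_four, Pi.smul_apply, smul_eq_mul]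
  simp only [mulVec, dotProduct, Fintype.sum_prod_type, prodKet, Finset.mul_sum]
  exact Finset.sum_congr rfl fun b _ => Finset.sum_congr rfl fun c _ => by ring

lemma unnormalizedPost_wcState (lam θ₂ θ₃ : ℝ) :
    unnormalizedPost (wcState 4 lam) θ₂ θ₃ =
      (1 / 4 : ℂ) • ensembleState (errorWeight 4 lam) (outerKet θ₂ θ₃) := by
  have hmix := mul_ensembleState_mul_conjTranspose (errorWeight 4 lam)
    (fun k => phaseError 4 k *ᵥ clusterKet 4) (middleKet θ₂ θ₃)ᴴ
  rw [conjTranspose_conjTranspose] at hmix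
  simp only [unnormalizedPost, wcState_eq_ensembleState, hmix,
    middleKet_conjTranspose_mulVec_phaseError, ensembleState_smul]
  norm_num

lemma tildeMatrix_outerKet_apply (θ₂ θ₃ : ℝ) (k l : Unit ⊕ Fin 4) :
    tildeMatrix (outerKet θ₂ θ₃) k l =
      (xzKet θ₂ ⬝ᵥ (((leftError k)ᵀ * pauliX * leftError l) *ᵥ xzKet θ₂)) *
        (xzKet θ₃ ⬝ᵥ (((rightError k)ᵀ * pauliX * rightError l) *ᵥ xzKet θ₃)) := by
  have hpull (φ χ : Fin 2 × Fin 2 → ℂ) :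
      (clusterGate *ᵥ φ) ⬝ᵥ ((pauliY ⊗ₖ pauliY) *ᵥ (clusterGate *ᵥ χ)) =
        φ ⬝ᵥ ((pauliX ⊗ₖ pauliX) *ᵥ χ) := by
    rw [← clusterGate_transpose_mul_pauliY_mul, ← mulVec_mulVec, ← mulVec_mulVec,
      dotProduct_mulVec φ, vecMul_transpose]
  rw [tildeMatrix, of_apply, outerKet, outerKet, hpull, kronecker_mulVec_prodKet,
    prodKet_dotProduct_prodKet]
  simp only [← mulVec_mulVec, dotProduct_mulVec (xzKet _), vecMul_transpose]

lemma leftError_conjTranspose_mul_self (k : Unit ⊕ Fin 4) :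
    (leftError k)ᴴ * leftError k = 1 := by
  rcases k with _ | k
  · simp [leftError]
  · fin_cases k <;> ext i j <;> fin_cases i <;> fin_cases j <;>
      simp [leftError, pauliX, pauliZ, mul_apply]

lemma rightError_conjTranspose_mul_self (k : Unit ⊕ Fin 4) :
    (rightError k)ᴴ * rightError k = 1 := by
  rcases k with _ | k
  · simp [rightError]
  · fin_cases k <;> ext i j <;> fin_cases i <;> fin_cases j <;>
      simp [rightError, pauliX, pauliZ, mul_apply]

lemma star_outerKet_dotProduct_self (θ₂ θ₃ : ℝ) (k : Unit ⊕ Fin 4) :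
    star (outerKet θ₂ θ₃ k) ⬝ᵥ outerKet θ₂ θ₃ k = 1 := by
  have hxz (θ : ℝ) : star (xzKet θ) ⬝ᵥ xzKet θ = 1 := by
    simpa [star_xzKet] using xzKet_dotProduct_mulVec θ 1
  rw [outerKet, star_mulVec_dotProduct_mulVec clusterGate_conjTranspose_mul_self,
    star_prodKet, prodKet_dotProduct_prodKet,
    star_mulVec_dotProduct_mulVec (leftError_conjTranspose_mul_self k),
    star_mulVec_dotProduct_mulVec (rightError_conjTranspose_mul_self k), hxz, hxz, one_mul]

lemma tildeMatrix_outerKet (θ₂ θ₃ : ℝ) :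
    tildeMatrix (outerKet θ₂ θ₃) =
      fromBlocks (of fun _ _ => (Real.sin θ₂ * Real.sin θ₃ : ℂ)) 0 0
        (pathMatrix (-(Real.sin θ₂ * Real.sin θ₃ : ℂ)) (-Real.sin θ₂)
          (Real.cos θ₂ * Real.cos θ₃) (-Real.sin θ₃)) := by
  ext k l
  rw [tildeMatrix_outerKet_apply]
  simp only [xzKet_dotProduct_mulVec]
  rcases k with _ | k <;> rcases l with _ | l
  · simp [leftError, rightError, pauliX]
  · fin_cases l <;> simp [leftError, rightError, pauliX, pauliZ, mul_apply]
  · fin_cases k <;> simp [leftError, rightError, pauliX, pauliZ, mul_apply]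
  · fin_cases k <;> fin_cases l <;>
      simp [leftError, rightError, pauliX, pauliZ, mul_apply, Fin.sum_univ_two, pathMatrix]

lemma isHermitian_tildeMatrix_outerKet (θ₂ θ₃ : ℝ) :
    (tildeMatrix (outerKet θ₂ θ₃)).IsHermitian := by
  rw [tildeMatrix_outerKet, isHermitian_fromBlocks_iff]
  refine ⟨?_, conjTranspose_zero, conjTranspose_zero, ?_⟩
  · ext
    simp [-Complex.ofReal_sin]
  · rw [IsHermitian, conjTranspose_pathMatrix]
    simp [-Complex.ofReal_sin, -Complex.ofReal_cos]

lemma trace_ensembleState_outerKet (lam θ₂ θ₃ : ℝ) :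
    (ensembleState (errorWeight 4 lam) (outerKet θ₂ θ₃)).trace = 1 := by
  rw [trace_ensembleState _ (star_outerKet_dotProduct_self θ₂ θ₃)]
  simp only [errorWeight, Nat.cast_ofNat, Fintype.sum_sum_type, Finset.univ_unique, Sum.elim_inl,
    Finset.sum_const, Finset.card_singleton, one_smul, Sum.elim_inr, Complex.ofReal_div,
    Complex.ofReal_sub, Complex.ofReal_one, Complex.ofReal_ofNat, Finset.card_univ,
    Fintype.card_fin, nsmul_eq_mul]
  ring

lemma outcomeProb_wcState (lam θ₂ θ₃ : ℝ) : outcomeProb (wcState 4 lam) θ₂ θ₃ = 1 / 4 := by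
  rw [outcomeProb, unnormalizedPost_wcState, trace_smul, trace_ensembleState_outerKet]
  norm_num

lemma postState_wcState (lam θ₂ θ₃ : ℝ) :
    postState (wcState 4 lam) θ₂ θ₃ =
      ensembleState (errorWeight 4 lam) (outerKet θ₂ θ₃) := by
  rw [postState, unnormalizedPost_wcState, trace_smul, trace_ensembleState_outerKet, smul_smul]
  norm_num

/-- The real numbers whose squares are the eigenvalues of `ρ * spinFlip ρ` for the post-measurement
state `ρ`, where `S = sin θ₂ * sin θ₃`. -/
def woottersValues (lam S : ℝ) : Multiset ℝ :=
  {lam * S, (1 - lam) / 4 * (1 - S), -((1 - lam) / 4 * (1 + S)), -((1 - lam) / 4 * (2 * S))}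

lemma sum_abs_woottersValues {lam S : ℝ} (hlam₀ : 0 ≤ lam) (hlam₁ : lam ≤ 1) (hS : |S| ≤ 1) :
    ((woottersValues lam S).map fun a => |a|).sum =
      lam * |S| + (1 - lam) / 2 * (1 + |S|) := by
  have hμ : 0 ≤ (1 - lam) / 4 := by linarith
  obtain ⟨hS₀, hS₁⟩ := abs_le.1 hS
  simp only [woottersValues, Multiset.insert_eq_cons, Multiset.map_cons, Multiset.map_singleton,
    Multiset.sum_cons, Multiset.sum_singleton, abs_neg, abs_mul, abs_two, abs_of_nonneg hlam₀,
    abs_of_nonneg hμ, abs_of_nonneg (sub_nonneg.2 hS₁),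
    abs_of_nonneg (neg_le_iff_add_nonneg'.1 hS₀)]
  ring

lemma exists_mem_woottersValues_abs_eq {lam : ℝ} (hlam₁ : lam ≤ 1) (S : ℝ) :
    ∃ a ∈ woottersValues lam S, |a| = (1 - lam) / 4 * (1 + |S|) := by
  have hμ : 0 ≤ (1 - lam) / 4 := by linarith
  rcases abs_cases S with ⟨hS, hS₀⟩ | ⟨hS, hS₀⟩
  · refine ⟨-((1 - lam) / 4 * (1 + S)), by simp [woottersValues], ?_⟩
    rw [abs_neg, abs_of_nonneg (by positivity), hS]
  · refine ⟨(1 - lam) / 4 * (1 - S), by simp [woottersValues], ?_⟩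
    rw [abs_of_nonneg (mul_nonneg hμ (by linarith)), hS, ← sub_eq_add_neg]

lemma abs_le_max_of_mem_woottersValues {lam S a : ℝ} (hlam₀ : 0 ≤ lam) (hlam₁ : lam ≤ 1)
    (hS : |S| ≤ 1) (ha : a ∈ woottersValues lam S) :
    |a| ≤ max (lam * |S|) ((1 - lam) / 4 * (1 + |S|)) := by
  have hμ : 0 ≤ (1 - lam) / 4 := by linarith
  simp only [woottersValues, Multiset.insert_eq_cons, Multiset.mem_cons,
    Multiset.mem_singleton] at ha
  rcases ha with rfl | rfl | rfl | rfl
  · exact le_max_of_le_left (by rw [abs_mul, abs_of_nonneg hlam₀])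
  all_goals
    refine le_max_of_le_right ?_
    simp only [abs_neg, abs_mul ((1 - lam) / 4), abs_of_nonneg hμ]
    refine mul_le_mul_of_nonneg_left ?_ hμ
  · simpa using abs_sub 1 S
  · simpa using abs_add_le 1 S
  · rw [abs_mul, abs_two]
    linarith

lemma diagonal_errorWeight (n : ℕ) (lam : ℝ) :
    diagonal (fun k => (errorWeight n lam k : ℂ)) =
      fromBlocks (diagonal fun _ => (lam : ℂ)) 0 0
        (diagonal fun _ => (((1 - lam) / n : ℝ) : ℂ)) := by
  rw [fromBlocks_diagonal]
  congr 1
  ext (_ | _) <;> rfl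

lemma charpoly_errorWeight_mul_tildeMatrix (lam θ₂ θ₃ : ℝ) :
    (diagonal (fun k => (errorWeight 4 lam k : ℂ)) * tildeMatrix (outerKet θ₂ θ₃)).charpoly =
      ((0 ::ₘ (woottersValues lam (Real.sin θ₂ * Real.sin θ₃)).map Complex.ofReal).map
        fun a => X - C a).prod := by
  set μ : ℂ := (((1 - lam) / (4 : ℕ) : ℝ) : ℂ) with hμ
  have hsin₂ : (Real.sin θ₂ : ℂ) ^ 2 + (Real.cos θ₂ : ℂ) ^ 2 = 1 := by
    exact_mod_cast Real.sin_sq_add_cos_sq θ₂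
  have hsin₃ : (Real.sin θ₃ : ℂ) ^ 2 + (Real.cos θ₃ : ℂ) ^ 2 = 1 := by
    exact_mod_cast Real.sin_sq_add_cos_sq θ₃
  have hunit : ((diagonal fun _ => (lam : ℂ)) *
      (of fun _ _ => (Real.sin θ₂ * Real.sin θ₃ : ℂ) : Matrix Unit Unit ℂ)).charpoly =
      X - C (lam * (Real.sin θ₂ * Real.sin θ₃) : ℂ) := by
    simp [Matrix.charpoly, charmatrix]
  rw [diagonal_errorWeight, tildeMatrix_outerKet, fromBlocks_multiply]
  simp only [Matrix.mul_zero, Matrix.zero_mul, add_zero, zero_add]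
  rw [charpoly_fromBlocks_zero₁₂, hunit, ← smul_eq_diagonal_mul, smul_pathMatrix,
    charpoly_pathMatrix (α := μ) (β := μ * (Real.sin θ₂ * Real.sin θ₃))]
  · simp [woottersValues, hμ, (map_ofNat C 2 : (C 2 : ℂ[X]) = 2)]
    ring
  · linear_combination μ ^ 2 * (1 - (Real.sin θ₃ : ℂ) ^ 2) * hsin₂ +
      μ ^ 2 * (Real.cos θ₂ : ℂ) ^ 2 * hsin₃
  · ring

lemma roots_charpoly_postState_mul_spinFlip (lam θ₂ θ₃ : ℝ) :
    (postState (wcState 4 lam) θ₂ θ₃ * spinFlip (postState (wcState 4 lam) θ₂ θ₃)).charpoly.roots =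
      (woottersValues lam (Real.sin θ₂ * Real.sin θ₃)).map fun a : ℝ => (a : ℂ) ^ 2 := by
  have hsq := charpoly_mul_self_eq_prod (charpoly_errorWeight_mul_tildeMatrix lam θ₂ θ₃)
  rw [Multiset.map_cons, Multiset.map_cons, Multiset.prod_cons, zero_pow two_ne_zero, C_0,
    sub_zero] at hsq
  have hcard : Fintype.card (Unit ⊕ Fin 4) = 4 + 1 := rfl
  have hmul := charpoly_ensembleState_mul_spinFlip (errorWeight 4 lam) (outerKet θ₂ θ₃)
  rw [(isHermitian_tildeMatrix_outerKet θ₂ θ₃).eq, hcard, pow_succ, mul_assoc] at hmul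
  have hcharpoly := (mul_left_cancel₀ (pow_ne_zero 4 X_ne_zero) hmul).trans hsq
  rw [postState_wcState, mul_left_cancel₀ X_ne_zero hcharpoly, roots_multiset_prod_X_sub_C,
    Multiset.map_map]
  rfl

lemma abs_sin_mul_sin_le_one (θ φ : ℝ) : |Real.sin θ * Real.sin φ| ≤ 1 := by
  rw [abs_mul]
  exact mul_le_one₀ (Real.abs_sin_le_one θ) (abs_nonneg _) (Real.abs_sin_le_one φ)

lemma concurrence_postState_wcState {lam : ℝ} (hlam₀ : 0 ≤ lam) (hlam₁ : lam ≤ 1) (θ₂ θ₃ : ℝ) :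
    concurrence (postState (wcState 4 lam) θ₂ θ₃) =
      max 0 (1 / 2 * (3 * lam - 1) * |Real.sin θ₂ * Real.sin θ₃| + 1 / 2 * (lam - 1)) := by
  have hroots := roots_charpoly_postState_mul_spinFlip lam θ₂ θ₃
  have hS := abs_sin_mul_sin_le_one θ₂ θ₃
  generalize Real.sin θ₂ * Real.sin θ₃ = S at hroots hS ⊢
  have hsum := sum_abs_woottersValues hlam₀ hlam₁ hS
  rcases le_total ((1 - lam) / 4 * (1 + |S|)) (lam * |S|) with h | h
  · have hlam : |lam * S| = lam * |S| := by rw [abs_mul, abs_of_nonneg hlam₀]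
    rw [concurrence_eq_of_roots hroots (a := lam * S) (by simp [woottersValues]), hsum, hlam]
    · ring_nf
    · rw [hlam]
      exact fun b hb => (abs_le_max_of_mem_woottersValues hlam₀ hlam₁ hS hb).trans (max_le le_rfl h)
  · obtain ⟨a, ha, habs⟩ : ∃ a ∈ woottersValues lam S, |a| = (1 - lam) / 4 * (1 + |S|) :=
      exists_mem_woottersValues_abs_eq hlam₁ S
    rw [concurrence_eq_of_roots hroots ha, hsum, habs, max_eq_left, max_eq_left]
    · linarith [abs_nonneg a]
    · linarith [mul_nonneg hlam₀ (abs_nonneg S)]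
    · rw [habs]
      exact fun b hb => (abs_le_max_of_mem_woottersValues hlam₀ hlam₁ hS hb).trans (max_le h le_rfl)

lemma localizedEntanglement_wcState {lam : ℝ} (hlam₀ : 0 ≤ lam) (hlam₁ : lam ≤ 1) (θ₂ θ₃ : ℝ) :
    localizedEntanglement (wcState 4 lam) θ₂ θ₃ =
      max 0 (1 / 2 * (3 * lam - 1) * |Real.sin θ₂ * Real.sin θ₃| + 1 / 2 * (lam - 1)) := by
  simp only [localizedEntanglement, outcomeProb_wcState,
    concurrence_postState_wcState hlam₀ hlam₁, Fin.sum_univ_two, Fin.val_zero, Fin.val_one,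
    Nat.cast_zero, Nat.cast_one, zero_mul, one_mul, add_zero, Real.sin_add_pi, mul_neg, neg_mul,
    abs_neg]
  ring

lemma max_zero_affine_le_max_zero_two_mul_sub_one {lam x : ℝ} (hx₀ : 0 ≤ x) (hx₁ : x ≤ 1) :
    max 0 (1 / 2 * (3 * lam - 1) * x + 1 / 2 * (lam - 1)) ≤ max 0 (2 * lam - 1) := by
  apply max_le (le_max_left _ _)
  rcases le_total (3 * lam - 1) 0 with h | h
  · exact le_max_of_le_left (by linarith [mul_nonpos_of_nonpos_of_nonneg h hx₀])
  · exact le_max_of_le_right (by linarith [mul_le_of_le_one_right h hx₁])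

end WorstCase

end WCState

end

theorem mainTheorem7 (lam : ℝ) (hlam₀ : 0 ≤ lam) (hlam₁ : lam ≤ 1) :
    -- every outcome occurs with positive probability, and the concurrence it leaves
    (∀ θ₂ θ₃ : ℝ,
      0 < WCState.outcomeProb (WCState.wcState 4 lam) θ₂ θ₃ ∧
      WCState.concurrence (WCState.postState (WCState.wcState 4 lam) θ₂ θ₃) =
        max 0 (1 / 2 * (3 * lam - 1) * |Real.sin θ₂ * Real.sin θ₃| + 1 / 2 * (lam - 1))) ∧
    -- the same without the absolute value
    (∀ θ₂ θ₃ : ℝ, 0 ≤ Real.sin θ₂ * Real.sin θ₃ →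
      WCState.concurrence (WCState.postState (WCState.wcState 4 lam) θ₂ θ₃) =
        max 0 (1 / 2 * (3 * lam - 1) * (Real.sin θ₂ * Real.sin θ₃) + 1 / 2 * (lam - 1))) ∧
    -- the average over the outcomes of the measurement
    (∀ θ₂ θ₃ : ℝ,
      WCState.localizedEntanglement (WCState.wcState 4 lam) θ₂ θ₃ =
        max 0 (1 / 2 * (3 * lam - 1) * |Real.sin θ₂ * Real.sin θ₃| + 1 / 2 * (lam - 1))) ∧
    -- equatorial measurements are optimal
    (∀ α β : ℝ, |Real.sin α * Real.sin β| = 1 →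
      WCState.concurrence (WCState.postState (WCState.wcState 4 lam) α β) = max 0 (2 * lam - 1) ∧
      WCState.localizedEntanglement (WCState.wcState 4 lam) α β = max 0 (2 * lam - 1) ∧
      ∀ θ₂ θ₃ : ℝ,
        WCState.concurrence (WCState.postState (WCState.wcState 4 lam) θ₂ θ₃) ≤
          WCState.concurrence (WCState.postState (WCState.wcState 4 lam) α β) ∧
        WCState.localizedEntanglement (WCState.wcState 4 lam) θ₂ θ₃ ≤
          WCState.localizedEntanglement (WCState.wcState 4 lam) α β) := by
  have hC := WCState.concurrence_postState_wcState hlam₀ hlam₁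
  have hE := WCState.localizedEntanglement_wcState hlam₀ hlam₁
  refine ⟨fun θ₂ θ₃ => ⟨?_, hC θ₂ θ₃⟩, fun θ₂ θ₃ hS => ?_, hE, fun α β hS => ?_⟩
  · rw [WCState.outcomeProb_wcState]
    norm_num
  · rw [hC, abs_of_nonneg hS]
  · have hmax : max 0 (1 / 2 * (3 * lam - 1) * |Real.sin α * Real.sin β| + 1 / 2 * (lam - 1)) =
        max 0 (2 * lam - 1) := by
      rw [hS]
      ring_nf
    have hle (θ₂ θ₃ : ℝ) := WCState.max_zero_affine_le_max_zero_two_mul_sub_one (lam := lam)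
      (abs_nonneg _) (WCState.abs_sin_mul_sin_le_one θ₂ θ₃)
    rw [hC α β, hE α β, hmax]
    exact ⟨rfl, rfl, fun θ₂ θ₃ =>
      ⟨(hC θ₂ θ₃).trans_le (hle θ₂ θ₃), (hE θ₂ θ₃).trans_le (hle θ₂ θ₃)⟩⟩
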